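/- Let $X$ be a Hausdorff space. An $\omega$-cover of $X$ is an open cover $\mathcal U$ of $X$ such that $X\notin\mathcal U$ and every finite subset of $X$ is contained in some member of $\mathcal U$; let $\Omega$ be the family of all $\omega$-covers of $X$. Let $\mathsf S_1(\Omega,\Omega)$ be the statement that for every sequence $(\mathcal U_n)_{n\in\mathbb N}$ in $\Omega$ there are $U_n\in\mathcal U_n$ with $\{U_n:n\in\mathbb N\}\in\Omega$, and let $\mathsf S_{fin}(\Omega,\Omega)$ be the statement that for every such sequence there are finite sets $\mathcal F_n\subseteq\mathcal U_n$ with $\bigcup_n\mathcal F_n\in\Omega$. For a positive integer $k$, let $$\binom{\Omega}{\Omega}\longrightarrow\left[\begin{array}{c}\Omega\\ \Omega\end{array}\right]^{1,1}_{k/<3}$$ be the statement that for all $\mathcal U,\mathcal V\in\Omega$ and every function $f:\mathcal U\times\mathcal V\to\{1,\dots,k\}$ there are $\mathcal K\subseteq\mathcal U$ and $\mathcal L\subseteq\mathcal V$ with $\mathcal K,\mathcal L\in\Omega$ such that $f$ takes fewer than $3$ values on $\mathcal K\times\mathcal L$. (a) If $X$ has property $\mathsf S_1(\Omega,\Omega)$,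 then $\binom{\Omega}{\Omega}\longrightarrow\left[\begin{array}{c}\Omega\\ \Omega\end{array}\right]^{1,1}_{k/<3}$ holds for every positive integer $k$. (b) Suppose that all finite powers of $X$ are Lindelöf. If $\binom{\Omega}{\Omega}\longrightarrow\left[\begin{array}{c}\Omega\\ \Omega\end{array}\right]^{1,1}_{k/<3}$ holds for every positive integer $k$, then $X$ has property $\mathsf S_{fin}(\Omega,\Omega)$. -/

import Mathlib

/-- The family `Ω` of all `ω`-covers of the space `X`: open covers `𝒰` of `X` such that `X` is not
a member of `𝒰`, but each finite subset of `X` is contained in a member of `𝒰`. -/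
def omegaCovers (X : Type*) [TopologicalSpace X] : Set (Set (Set X)) :=
  {𝒰 | (∀ U ∈ 𝒰, IsOpen U) ∧ ⋃₀ 𝒰 = Set.univ ∧ Set.univ ∉ 𝒰 ∧
    ∀ F : Set X, F.Finite → ∃ U ∈ 𝒰, F ⊆ U}

/-- The selection principle `S₁(𝒜, ℬ)`: for each sequence `(O n)` of elements of `𝒜` there are
`T n ∈ O n` such that `{T n : n ∈ ℕ}` is an element of `ℬ`. -/
def SelOne {α : Type*} (𝒜 ℬ : Set (Set α)) : Prop :=
  ∀ O : ℕ → Set α, (∀ n, O n ∈ 𝒜) →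
    ∃ T : ℕ → α, (∀ n, T n ∈ O n) ∧ Set.range T ∈ ℬ

/-- The selection principle `S_fin(𝒜, ℬ)`: for each sequence `(O n)` of elements of `𝒜` there are
finite sets `F n ⊆ O n` such that `⋃ n, F n` is an element of `ℬ`. -/
def SelFin {α : Type*} (𝒜 ℬ : Set (Set α)) : Prop :=
  ∀ O : ℕ → Set α, (∀ n, O n ∈ 𝒜) →
    ∃ F : ℕ → Set α, (∀ n, (F n).Finite ∧ F n ⊆ O n) ∧ (⋃ n, F n) ∈ ℬ

/-- The square bracket polarized partition relation
`(𝒜₁ over 𝒜₂) → [ℬ₁ over ℬ₂]^{1,1}_{k/<ℓ}`: for all `A₁ ∈ 𝒜₁`, `A₂ ∈ 𝒜₂` and each colouring of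
`A₁ × A₂` with `k` colours there are `B₁ ⊆ A₁` in `ℬ₁` and `B₂ ⊆ A₂` in `ℬ₂` such that fewer than
`ℓ` colours occur on `B₁ × B₂`. -/
def PolarizedSquareBracket {α β : Type*} (𝒜₁ : Set (Set α)) (𝒜₂ : Set (Set β))
    (ℬ₁ : Set (Set α)) (ℬ₂ : Set (Set β)) (k ℓ : ℕ) : Prop :=
  ∀ A₁ ∈ 𝒜₁, ∀ A₂ ∈ 𝒜₂, ∀ f : A₁ × A₂ → Fin k,
    ∃ B₁ ∈ ℬ₁, ∃ B₂ ∈ ℬ₂, B₁ ⊆ A₁ ∧ B₂ ⊆ A₂ ∧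
      (f '' {p | (p.1 : α) ∈ B₁ ∧ (p.2 : β) ∈ B₂}).ncard < ℓ

open Filter

section OmegaCovers

variable {X : Type*} [TopologicalSpace X]

-- For (a), `S₁` makes both covers countable, and ultrafilters `p`, `q` on the indices, all of whose
-- members index `ω`-covers, give the colouring two iterated limits: `c` (inner limit along `q`) and
-- `d` (inner limit along `p`). Applying `S₁` to tails thins the covers so that a pair has colour
-- `c` when its second index is far beyond the first and `d` in the opposite case. Pairs of
-- comparable index are avoided by partitioning ℕ into finite blocks and choosing indices from
-- pairwise non-adjacent blocks; `S₁`, applied to intersections of terms from many blocks, leaves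
-- room for a greedy choice. For (b), an `ω`-cover by sets `u 0 n ∩ u (n + 1) m` encodes a sequence
-- of covers. Three colours compare `n` and `m` with the first index of another member. Omitting a
-- colour bounds `m` in terms of `n`, which gives the finite selections.

theorem omegaCovers_of_finset {𝒰 : Set (Set X)} (ho : ∀ U ∈ 𝒰, IsOpen U) (hu : Set.univ ∉ 𝒰)
    (hF : ∀ F : Finset X, ∃ U ∈ 𝒰, (F : Set X) ⊆ U) : 𝒰 ∈ omegaCovers X := by
  refine ⟨ho, Set.eq_univ_of_forall fun x => ?_, hu, fun F hFin => ?_⟩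
  · obtain ⟨U, hU, h⟩ := hF {x}
    exact ⟨U, hU, h (by simp)⟩
  · simpa using hF hFin.toFinset

theorem omegaCovers_of_subset {𝒰 𝒱 : Set (Set X)} (h𝒰 : 𝒰 ∈ omegaCovers X) (hs : 𝒱 ⊆ 𝒰)
    (hF : ∀ F : Finset X, ∃ U ∈ 𝒱, (F : Set X) ⊆ U) : 𝒱 ∈ omegaCovers X :=
  omegaCovers_of_finset (fun U hU => h𝒰.1 U (hs hU)) (fun h => h𝒰.2.2.1 (hs h)) hF

/-- If an `ω`-cover is enumerated as `u`, then each finite set is contained in infinitely many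
terms of the enumeration. -/
theorem infinite_setOf_subset_of_omegaCovers {u : ℕ → Set X}
    (hu : Set.range u ∈ omegaCovers X) (F : Finset X) : {n | (F : Set X) ⊆ u n}.Infinite := by
  classical
  intro hfin
  have hx : ∀ n, ∃ x, x ∉ u n := fun n => by
    by_contra! h
    exact hu.2.2.1 ⟨n, Set.eq_univ_of_forall h⟩
  choose x hx using hx
  -- Enlarge `F` by a point missed by each of the finitely many terms containing `F`; a term
  -- covering the result contains its own missed point.
  obtain ⟨U, ⟨n, rfl⟩, hn⟩ :=
    hu.2.2.2 (F ∪ x '' {n | (F : Set X) ⊆ u n}) (F.finite_toSet.union (hfin.image x))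
  exact hx n (hn (Or.inr ⟨n, (Set.subset_union_left.trans hn : (F : Set X) ⊆ u n), rfl⟩))

/-- An enumerated `ω`-cover carries an ultrafilter on the indices all of whose members index
`ω`-covers. -/
theorem exists_ultrafilter_of_omegaCovers {u : ℕ → Set X} (hu : Set.range u ∈ omegaCovers X) :
    ∃ p : Ultrafilter ℕ, ∀ A ∈ p, u '' A ∈ omegaCovers X := by
  have h : ∀ F : Finset X, ∃ n, (F : Set X) ⊆ u n := fun F => by
    obtain ⟨_, ⟨n, rfl⟩, h⟩ := hu.2.2.2 F F.finite_toSet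
    exact ⟨n, h⟩
  choose g hg using h
  -- Along the directed set of finite `F`, the indices `g F` eventually capture any given finite
  -- set.
  refine ⟨Ultrafilter.of (map g atTop), fun A hA => ?_⟩
  refine omegaCovers_of_subset hu (Set.image_subset_range _ _) fun F => ?_
  have hF : ∀ᶠ n in (Ultrafilter.of (map g atTop) : Filter ℕ), (F : Set X) ⊆ u n := by
    refine Ultrafilter.of_le _ (eventually_map.2 ?_)
    filter_upwards [eventually_ge_atTop F] with G hG
    exact (Finset.coe_subset.2 hG).trans (hg G)
  obtain ⟨n, hn, hnA⟩ := (hF.and hA).exists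
  exact ⟨u n, ⟨n, hnA, rfl⟩, hn⟩

theorem Ultrafilter.exists_eventually_eq_of_finite {α β : Type*} [Finite β] (p : Ultrafilter α)
    (g : α → β) : ∃ c, ∀ᶠ a in (p : Filter α), g a = c := by
  obtain ⟨c, hc⟩ := (p.map g).eq_pure_of_finite
  refine ⟨c, ?_⟩
  have : ({c} : Set β) ∈ p.map g := by rw [hc]; simp
  exact this

-- Separated index sets

/-- For each `h` the natural numbers can be partitioned into finite blocks such that non-adjacent
blocks are `h` apart. -/
theorem exists_block_function (h : ℕ → ℕ) :
    ∃ b : ℕ → ℕ, (∀ k, (b ⁻¹' {k}).Finite) ∧ ∀ i j, b i + 1 < b j → h i ≤ j := by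
  classical
  -- `H x` exceeds `x` and bounds `h` below `x`. Blocks end at the iterates `N k`, so skipping a
  -- whole block passes `h i`.
  let H : ℕ → ℕ := fun x => x + 1 + ∑ i ∈ Finset.range x, h i
  let N : ℕ → ℕ := fun k => H^[k] 0
  have hN : ∀ k, N (k + 1) = H (N k) := fun k => Function.iterate_succ_apply' H k 0
  have hmono : StrictMono N := strictMono_nat_of_lt_succ fun k => by
    rw [hN]; simp only [H]; omega
  have hex : ∀ i, ∃ k, i < N k := fun i => ⟨i + 1, (Nat.lt_succ_self i).trans_le (hmono.id_le _)⟩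
  refine ⟨fun i => Nat.find (hex i), fun k => ?_, fun i j hij => ?_⟩
  · refine (Set.finite_lt_nat (N k)).subset fun i hi => ?_
    have := Nat.find_spec (hex i)
    rwa [show Nat.find (hex i) = k from hi] at this
  · have h1 : N (Nat.find (hex i) + 1) ≤ j := not_lt.1 (Nat.find_min (hex j) hij)
    have h2 := Nat.find_spec (hex i)
    have h3 : h i ≤ ∑ i ∈ Finset.range (N (Nat.find (hex i))), h i :=
      Finset.single_le_sum (f := h) (fun _ _ => Nat.zero_le _) (Finset.mem_range.2 h2)
    rw [hN] at h1
    simp only [H] at h1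
    omega

/-- Greedy choice: each of the `k` earlier choices forbids at most three blocks, its own and the two
neighbours. -/
theorem exists_separated_selector (b : ℕ → ℕ) (r : ℕ → Finset ℕ)
    (hr : ∀ k, 3 * k < ((r k).image b).card) :
    ∃ x : ℕ → ℕ, (∀ k, x k ∈ r k) ∧
      ∀ m k, m < k → b (x m) + 1 < b (x k) ∨ b (x k) + 1 < b (x m) := by
  classical
  have step : ∀ (k : ℕ) (y : ∀ m, m < k → ℕ), ∃ z ∈ r k,
      ∀ m (hm : m < k), b (y m hm) + 1 < b z ∨ b z + 1 < b (y m hm) := by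
    intro k y
    let bad : Finset ℕ := (Finset.univ : Finset (Fin k)).biUnion fun m =>
      {b (y m m.2) - 1, b (y m m.2), b (y m m.2) + 1}
    have hbad : bad.card ≤ k * 3 := by
      simpa using Finset.card_biUnion_le_card_mul (Finset.univ : Finset (Fin k))
        (fun m => {b (y m m.2) - 1, b (y m m.2), b (y m m.2) + 1}) 3
        fun _ _ => Finset.card_le_three
    obtain ⟨w, hw, hwb⟩ := Finset.exists_mem_notMem_of_card_lt_card
      (s := bad) (t := (r k).image b) (by have := hr k; omega)
    obtain ⟨z, hz, rfl⟩ := Finset.mem_image.1 hw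
    refine ⟨z, hz, fun m hm => ?_⟩
    simp only [bad, Finset.mem_biUnion, Finset.mem_univ, true_and, not_exists, Finset.mem_insert,
      Finset.mem_singleton] at hwb
    have := hwb ⟨m, hm⟩
    simp only at this
    omega
  choose z hz hsep using step
  let x : ℕ → ℕ := fun n => Nat.strongRec (motive := fun _ => ℕ) (fun k y => z k y) n
  have hx : ∀ k, x k = z k fun m _ => x m := fun k => by
    simp only [x]
    rw [Nat.strongRec]
  refine ⟨x, fun k => ?_, fun m k hmk => ?_⟩
  · rw [hx]; exact hz _ _
  · rw [hx k]; exact hsep k (fun m _ => x m) m hmk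

/-- Under `S₁(Ω, Ω)` one finds in an enumerated `ω`-cover finite sets of indices meeting
prescribed numbers of blocks, such that the intersections over them capture all finite sets. -/
theorem SelOne.exists_large_finsets (hS : SelOne (omegaCovers X) (omegaCovers X))
    {u : ℕ → Set X} (hu : Set.range u ∈ omegaCovers X) {b : ℕ → ℕ}
    (hb : ∀ k, (b ⁻¹' {k}).Finite) (N : ℕ → ℕ) :
    ∃ s : ℕ → Finset ℕ, (∀ n, N n < ((s n).image b).card) ∧
      ∀ F : Finset X, ∃ n, ∀ i ∈ s n, (F : Set X) ⊆ u i := by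
  let O : ℕ → Set (Set X) := fun n =>
    {W | ∃ s : Finset ℕ, N n < (s.image b).card ∧ W = ⋂ i ∈ s, u i}
  have hO : ∀ n, O n ∈ omegaCovers X := by
    intro n
    refine omegaCovers_of_finset ?_ ?_ fun F => ?_
    · rintro _ ⟨s, -, rfl⟩
      exact isOpen_biInter_finset fun i _ => hu.1 _ ⟨i, rfl⟩
    · rintro ⟨s, hs, hW⟩
      have hne : (s.image b).Nonempty := Finset.card_pos.1 (by omega)
      obtain ⟨i, hi⟩ := Finset.image_nonempty.1 hne
      refine hu.2.2.1 ⟨i, Set.univ_subset_iff.1 ?_⟩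
      rw [hW]
      exact Set.biInter_subset_of_mem hi
    -- Infinitely many indices capture `F` and blocks are finite, so these indices meet infinitely
    -- many blocks.
    · have hinf : (b '' {i | (F : Set X) ⊆ u i}).Infinite := by
        intro hfin
        refine infinite_setOf_subset_of_omegaCovers hu F ?_
        exact (hfin.preimage' fun k _ => hb k).subset (Set.subset_preimage_image _ _)
      obtain ⟨t, ht, htc⟩ := hinf.exists_subset_card_eq (N n + 1)
      obtain ⟨s, hs, rfl⟩ := Finset.subset_set_image_iff.1 ht
      exact ⟨_, ⟨s, by omega, rfl⟩, Set.subset_iInter₂ fun i hi => hs hi⟩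
  obtain ⟨T, hT, hΩ⟩ := hS O hO
  choose s hs hTs using hT
  refine ⟨s, hs, fun F => ?_⟩
  obtain ⟨_, ⟨n, rfl⟩, hn⟩ := hΩ.2.2.2 F F.finite_toSet
  rw [hTs] at hn
  exact ⟨n, fun i hi => hn.trans (Set.biInter_subset_of_mem hi)⟩

/-- Under `S₁(Ω, Ω)` two enumerated `ω`-covers can be thinned out to `ω`-covers whose indices are
mutually far apart. -/
theorem SelOne.exists_separated_index_sets (hS : SelOne (omegaCovers X) (omegaCovers X))
    {u v : ℕ → Set X} (hu : Set.range u ∈ omegaCovers X) (hv : Set.range v ∈ omegaCovers X)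
    (h : ℕ → ℕ) :
    ∃ I J : Set ℕ, u '' I ∈ omegaCovers X ∧ v '' J ∈ omegaCovers X ∧
      ∀ i ∈ I, ∀ j ∈ J, h i ≤ j ∨ h j ≤ i := by
  obtain ⟨b, hb, hbh⟩ := exists_block_function h
  -- The two families are interleaved: `s n` serves stage `2 * n` of the greedy choice, `t n` stage
  -- `2 * n + 1`.
  obtain ⟨s, hs, hsF⟩ := hS.exists_large_finsets hu hb fun n => 3 * (2 * n)
  obtain ⟨t, ht, htF⟩ := hS.exists_large_finsets hv hb fun n => 3 * (2 * n + 1)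
  obtain ⟨x, hx, hsep⟩ := exists_separated_selector b
    (fun k => if k % 2 = 0 then s (k / 2) else t (k / 2)) fun k => by
      split_ifs with hk
      · have := hs (k / 2); omega
      · have := ht (k / 2); omega
  have hxs : ∀ n, x (2 * n) ∈ s n := fun n => by simpa using hx (2 * n)
  have hxt : ∀ n, x (2 * n + 1) ∈ t n := fun n => by
    have := hx (2 * n + 1)
    rwa [if_neg (by omega), show (2 * n + 1) / 2 = n by omega] at this
  refine ⟨Set.range fun n => x (2 * n), Set.range fun n => x (2 * n + 1), ?_, ?_, ?_⟩
  · refine omegaCovers_of_subset hu (Set.image_subset_range _ _) fun F => ?_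
    obtain ⟨n, hn⟩ := hsF F
    exact ⟨_, ⟨_, ⟨n, rfl⟩, rfl⟩, hn _ (hxs n)⟩
  · refine omegaCovers_of_subset hv (Set.image_subset_range _ _) fun F => ?_
    obtain ⟨n, hn⟩ := htF F
    exact ⟨_, ⟨_, ⟨n, rfl⟩, rfl⟩, hn _ (hxt n)⟩
  · rintro _ ⟨n, rfl⟩ _ ⟨m, rfl⟩
    rcases lt_or_gt_of_ne (show 2 * n ≠ 2 * m + 1 by omega) with hlt | hlt
    · exact (hsep _ _ hlt).imp (hbh _ _) (hbh _ _)
    · exact ((hsep _ _ hlt).imp (hbh _ _) (hbh _ _)).symm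

-- Part (a): the two limit colours

theorem SelOne.polarizedSquareBracket (hS : SelOne (omegaCovers X) (omegaCovers X)) (k : ℕ) :
    PolarizedSquareBracket (omegaCovers X) (omegaCovers X) (omegaCovers X) (omegaCovers X) k 3 := by
  intro 𝒰 h𝒰 𝒱 h𝒱 f
  obtain ⟨u, hu𝒰, hu⟩ := hS (fun _ => 𝒰) fun _ => h𝒰
  obtain ⟨v, hv𝒱, hv⟩ := hS (fun _ => 𝒱) fun _ => h𝒱
  obtain ⟨p, hp⟩ := exists_ultrafilter_of_omegaCovers hu
  obtain ⟨q, hq⟩ := exists_ultrafilter_of_omegaCovers hv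
  let g : ℕ → ℕ → Fin k := fun n m => f (⟨u n, hu𝒰 n⟩, ⟨v m, hv𝒱 m⟩)
  choose c' hc' using fun n => q.exists_eventually_eq_of_finite fun m => g n m
  choose d' hd' using fun m => p.exists_eventually_eq_of_finite fun n => g n m
  obtain ⟨c, hc⟩ := p.exists_eventually_eq_of_finite c'
  obtain ⟨d, hd⟩ := q.exists_eventually_eq_of_finite d'
  have hP : ∀ i : ℕ, u '' {n | c' n = c ∧ ∀ m < i, d' m = d → g n m = d} ∈ omegaCovers X := by
    intro i
    refine hp _ (hc.and ?_)
    refine (eventually_all_finite (Set.finite_lt_nat i)).2 fun m _ => ?_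
    filter_upwards [hd' m] with n hn hm
    rw [hn, hm]
  have hQ : ∀ j : ℕ, v '' {m | d' m = d ∧ ∀ n < j, c' n = c → g n m = c} ∈ omegaCovers X := by
    intro j
    refine hq _ (hd.and ?_)
    refine (eventually_all_finite (Set.finite_lt_nat j)).2 fun n _ => ?_
    filter_upwards [hc' n] with m hm hn
    rw [hm, hn]
  obtain ⟨T, hT, hTΩ⟩ := hS _ hP
  obtain ⟨S, hS', hSΩ⟩ := hS _ hQ
  choose a ha haT using hT
  choose b hb hbS using hS'
  -- Separation gives `a i < j`, forcing colour `c`, or `b j < i`, forcing colour `d`; the `+ 1`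
  -- makes these strict.
  obtain ⟨I, J, hI, hJ, hIJ⟩ := hS.exists_separated_index_sets hTΩ hSΩ fun i => max (a i) (b i) + 1
  refine ⟨_, hI, _, hJ, ?_, ?_, ?_⟩
  · rintro _ ⟨i, -, rfl⟩
    rw [← haT]; exact hu𝒰 _
  · rintro _ ⟨j, -, rfl⟩
    rw [← hbS]; exact hv𝒱 _
  · have hsub : f '' {x | (x.1 : Set X) ∈ T '' I ∧ (x.2 : Set X) ∈ S '' J} ⊆ {c, d} := by
      rintro _ ⟨⟨⟨U, hU⟩, ⟨V, hV⟩⟩, ⟨⟨i, hi, hiU⟩, ⟨j, hj, hjV⟩⟩, rfl⟩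
      dsimp only at hiU hjV
      have hg : f (⟨U, hU⟩, ⟨V, hV⟩) = g (a i) (b j) := by
        simp only [g, haT, hbS, hiU, hjV]
      rw [hg]
      rcases hIJ i hi j hj with hlt | hlt
      · exact Or.inl ((hb j).2 (a i) (by omega) (ha i).1)
      · exact Or.inr ((ha i).2 (b j) (by omega) (hb j).1)
    calc _ ≤ ({c, d} : Set (Fin k)).ncard := Set.ncard_le_ncard hsub (Set.toFinite _)
      _ ≤ 2 := (Set.ncard_insert_le _ _).trans (by rw [Set.ncard_singleton])
      _ < 3 := by omega

-- Part (b): Lindelöf powers and finite selections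

/-- If all finite powers of `X` are Lindelöf, then each `ω`-cover has a countable `ω`-subcover. -/
theorem exists_countable_omegaCovers_subset (hL : ∀ n : ℕ, LindelofSpace (Fin n → X))
    {𝒰 : Set (Set X)} (h𝒰 : 𝒰 ∈ omegaCovers X) :
    ∃ u : ℕ → Set X, (∀ n, u n ∈ 𝒰) ∧ Set.range u ∈ omegaCovers X := by
  have h : ∀ n : ℕ, ∃ 𝒱 : Set (Set X), 𝒱 ⊆ 𝒰 ∧ 𝒱.Countable ∧
      ∀ x : Fin n → X, ∃ U ∈ 𝒱, ∀ i, x i ∈ U := by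
    intro n
    -- The powers `Uⁿ` cover `Xⁿ`, since a tuple has finite range.
    obtain ⟨r, hr, hcov⟩ := (isLindelof_univ (X := Fin n → X)).elim_countable_subcover
      (fun U : 𝒰 => Set.univ.pi fun _ : Fin n => (U : Set X))
      (fun U => isOpen_set_pi Set.finite_univ fun _ _ => h𝒰.1 _ U.2) (by
        intro x _
        obtain ⟨U, hU, hxU⟩ := h𝒰.2.2.2 (Set.range x) (Set.finite_range x)
        exact Set.mem_iUnion.2 ⟨⟨U, hU⟩, fun i _ => hxU ⟨i, rfl⟩⟩)
    refine ⟨(↑) '' r, by simp, hr.image _, fun x => ?_⟩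
    obtain ⟨U, hU, hx⟩ := Set.mem_iUnion₂.1 (hcov (Set.mem_univ x))
    exact ⟨U, ⟨U, hU, rfl⟩, fun i => hx i trivial⟩
  choose 𝒱 hsub hcount hcov using h
  have hF : ∀ F : Finset X, ∃ U ∈ ⋃ n, 𝒱 n, (F : Set X) ⊆ U := by
    intro F
    obtain ⟨U, hU, hx⟩ := hcov F.card fun i => (F.equivFin.symm i : X)
    refine ⟨U, Set.mem_iUnion.2 ⟨_, hU⟩, fun y hy => ?_⟩
    simpa using hx (F.equivFin ⟨y, hy⟩)
  have hΩ : (⋃ n, 𝒱 n) ∈ omegaCovers X :=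
    omegaCovers_of_subset h𝒰 (Set.iUnion_subset hsub) hF
  obtain ⟨U, hU, -⟩ := hF ∅
  obtain ⟨u, hu⟩ := (Set.countable_iUnion hcount).exists_eq_range ⟨U, hU⟩
  refine ⟨u, fun n => Set.iUnion_subset hsub (hu ▸ ⟨n, rfl⟩), hu ▸ hΩ⟩

theorem selFin_of_polarizedSquareBracket (hL : ∀ n : ℕ, LindelofSpace (Fin n → X))
    (hP : PolarizedSquareBracket (omegaCovers X) (omegaCovers X) (omegaCovers X) (omegaCovers X)
      3 3) : SelFin (omegaCovers X) (omegaCovers X) := by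
  classical
  intro O hO
  choose u huO hu using fun n => exists_countable_omegaCovers_subset hL (hO n)
  let 𝒲 : Set (Set X) := {W | ∃ n m : ℕ, W = u 0 n ∩ u (n + 1) m}
  have hne : ∀ n m, u n m ≠ Set.univ := fun n m h => (hu n).2.2.1 ⟨m, h⟩
  have h𝒲 : 𝒲 ∈ omegaCovers X := by
    refine omegaCovers_of_finset ?_ ?_ fun F => ?_
    · rintro _ ⟨n, m, rfl⟩
      exact ((hu 0).1 _ ⟨n, rfl⟩).inter ((hu (n + 1)).1 _ ⟨m, rfl⟩)
    · rintro ⟨n, m, h⟩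
      exact hne 0 n (Set.univ_subset_iff.1 (h ▸ Set.inter_subset_left))
    · obtain ⟨_, ⟨n, rfl⟩, hn⟩ := (hu 0).2.2.2 F F.finite_toSet
      obtain ⟨_, ⟨m, rfl⟩, hm⟩ := (hu (n + 1)).2.2.2 F F.finite_toSet
      exact ⟨_, ⟨n, m, rfl⟩, Set.subset_inter hn hm⟩
  choose ν μ hW using fun W : 𝒲 => W.2
  have unbounded : ∀ 𝒦 ∈ omegaCovers X, 𝒦 ⊆ 𝒲 → ∀ N : ℕ, ∃ W : 𝒲, (W : Set X) ∈ 𝒦 ∧ N < ν W := by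
    intro 𝒦 h𝒦 hsub N
    -- A member containing a point outside each `u 0 n` with `n ≤ N` must have `ν > N`.
    choose x hx using fun n => (Set.ne_univ_iff_exists_notMem _).1 (hne 0 n)
    obtain ⟨W, hWK, hxW⟩ := h𝒦.2.2.2 (x '' {n | n ≤ N}) ((Set.finite_le_nat N).image x)
    refine ⟨⟨W, hsub hWK⟩, hWK, not_le.1 fun hle => ?_⟩
    have h1 := hxW ⟨ν ⟨W, hsub hWK⟩, hle, rfl⟩
    have h2 := hW ⟨W, hsub hWK⟩
    exact hx _ (h2.subset h1).1
  let f : 𝒲 × 𝒲 → Fin 3 := fun p =>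
    if ν p.2 ≤ ν p.1 then 0 else if μ p.1 ≤ ν p.2 then 1 else 2
  obtain ⟨𝒦, h𝒦, ℒ, hℒ, h𝒦𝒲, hℒ𝒲, hcard⟩ := hP 𝒲 h𝒲 𝒲 h𝒲 f
  -- A violating pair has colour 2. As `ν` is unbounded on `𝒦` and `ℒ`, moving `W` far out gives
  -- colour 0 and moving `V` far out gives colour 1, so all three colours would occur.
  have bound : ∀ W V : 𝒲, (W : Set X) ∈ 𝒦 → (V : Set X) ∈ ℒ → ν W < ν V → μ W ≤ ν V := by
    intro W V hWK hVL hlt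
    by_contra hμ
    obtain ⟨W', hW'K, hW'⟩ := unbounded 𝒦 h𝒦 h𝒦𝒲 (ν V)
    obtain ⟨V', hV'L, hV'⟩ := unbounded ℒ hℒ hℒ𝒲 (max (ν W) (μ W))
    have huniv : f '' {p | (p.1 : Set X) ∈ 𝒦 ∧ (p.2 : Set X) ∈ ℒ} = Set.univ := by
      refine Set.eq_univ_of_forall fun c => ?_
      fin_cases c
      · exact ⟨(W', V), ⟨hW'K, hVL⟩, if_pos hW'.le⟩
      · refine ⟨(W, V'), ⟨hWK, hV'L⟩, ?_⟩
        exact (if_neg (by dsimp only; omega)).trans (if_pos (by dsimp only; omega))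
      · refine ⟨(W, V), ⟨hWK, hVL⟩, ?_⟩
        exact (if_neg (by dsimp only; omega)).trans (if_neg hμ)
    rw [huniv, Set.ncard_univ, Nat.card_fin] at hcard
    exact lt_irrefl _ hcard
  choose V hVL hV using unbounded ℒ hℒ hℒ𝒲
  -- The shift matches `u (n + 1)` being paired with `ν = n`; `G 0` plays no role in the covering.
  let G : ℕ → Set (Set X) := fun n => u n '' {m | m ≤ ν (V (n - 1))}
  have hG : ∀ n, G n ⊆ O n := fun n => by
    rintro _ ⟨m, -, rfl⟩
    exact huO n m
  refine ⟨G, fun n => ⟨(Set.finite_le_nat _).image _, hG n⟩, ?_⟩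
  refine omegaCovers_of_finset ?_ ?_ fun F => ?_
  · rintro U hU
    obtain ⟨n, hn⟩ := Set.mem_iUnion.1 hU
    exact (hO n).1 U (hG n hn)
  · intro hU
    obtain ⟨n, hn⟩ := Set.mem_iUnion.1 hU
    exact (hO n).2.2.1 (hG n hn)
  · obtain ⟨W, hWK, hFW⟩ := h𝒦.2.2.2 F F.finite_toSet
    let W' : 𝒲 := ⟨W, h𝒦𝒲 hWK⟩
    refine ⟨u (ν W' + 1) (μ W'), Set.mem_iUnion.2 ⟨ν W' + 1, μ W', ?_, rfl⟩, ?_⟩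
    · exact bound W' _ hWK (hVL _) (hV _)
    · have h2 : W = _ := hW W'
      exact hFW.trans (h2.subset.trans Set.inter_subset_right)

end OmegaCovers

theorem mainTheorem11 (X : Type*) [TopologicalSpace X] [T2Space X] :
    (SelOne (omegaCovers X) (omegaCovers X) →
      ∀ k : ℕ, 0 < k →
        PolarizedSquareBracket (omegaCovers X) (omegaCovers X) (omegaCovers X) (omegaCovers X) k 3) ∧
    ((∀ n : ℕ, LindelofSpace (Fin n → X)) →
      (∀ k : ℕ, 0 < k →
        PolarizedSquareBracket (omegaCovers X) (omegaCovers X) (omegaCovers X) (omegaCovers X) k 3) →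
      SelFin (omegaCovers X) (omegaCovers X)) :=
  ⟨fun hS k _ => hS.polarizedSquareBracket k,
    fun hL hP => selFin_of_polarizedSquareBracket hL (hP 3 (by omega))⟩
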